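/- Let $E$ be a real Banach space which is uniformly convex, with modulus of convexity $$\delta_E(\varepsilon)=\sup\Big\{\delta\ge 0:\ B_\delta\big(\tfrac{x_1+x_2}{2}\big)\subset B_1(0)\ \text{ for all } x_1,x_2\in B_1(0) \text{ with } \|x_1-x_2\|=\varepsilon\Big\},\qquad 0\le\varepsilon<2,$$ where $B_\rho(x)$ denotes the closed ball of radius $\rho$ centred at $x$. For a nonempty closed set $A\subset E$ let $$\gamma_A(\varepsilon)=\inf\Big\{\gamma>0:\ B_\gamma\big(\tfrac{x_1+x_2}{2}\big)\cap A\ne\emptyset\ \text{ for all } x_1,x_2\in A \text{ with } \|x_1-x_2\|\le\varepsilon\Big\},\qquad \varepsilon\ge 0,$$ be its modulus of nonconvexity, let $\varrho(x,A)=\inf_{b\in A}\|x-b\|$, and let $P_Ax=\{b\in A:\ \|x-b\|=\varrho(x,A)\}$ be the metric projection. **Theorem 3.4.** Let $d>0$ and let $A\subset E$ be nonempty, closed and weakly convex on $[0,2d)$, i.e. $\gamma_A(\varepsilon)<\varepsilon/2$ for all $\varepsilon\in(0,2d)$. Suppose that $\gamma_A(\varepsilon)<d\,\delta_E(\varepsilon/d)$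 for all $\varepsilon\in(0,2d)$, and that $A\subset B_r(a)$ for some $a\in E$ and some $r$ with $2r<d$. Then $A$ is a continuous retract of $E$. More precisely, for every $x\in E$ the set $P_{\mathrm{cl\,co}A}\,x$ is a single point $y(x)$ of the closed convex hull of $A$, the set $P_A\,y(x)$ is a single point $z(x)$ of $A$, and the map $z:E\to A$, $z(x)=P_A(P_{\mathrm{cl\,co}A}\,x)$, is continuous, satisfies $z(x)=x$ for all $x\in A$, and is uniformly continuous on every ball of $E$. -/

import Mathlib

noncomputable section

variable {E : Type*} [NormedAddCommGroup E] [NormedSpace ℝ E]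

/-- The modulus of convexity `δ_C(ε)` of a set `C`: the supremum of all `δ ≥ 0` such that the closed
ball of radius `δ` about the midpoint of `x₁, x₂` lies in `C` whenever `x₁, x₂ ∈ C` are at distance
exactly `ε`.  It is used for `0 ≤ ε < diam C`. -/
def modulusOfConvexity (C : Set E) (ε : ℝ) : ℝ :=
  sSup {δ : ℝ | 0 ≤ δ ∧ ∀ x₁ ∈ C, ∀ x₂ ∈ C, ‖x₁ - x₂‖ = ε →
    Metric.closedBall (midpoint ℝ x₁ x₂) δ ⊆ C}

variable (E) in
/-- The modulus of convexity `δ_E` of the space: that of its closed unit ball. -/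
def spaceModulusOfConvexity (ε : ℝ) : ℝ :=
  modulusOfConvexity (Metric.closedBall (0 : E) 1) ε

/-- The modulus of nonconvexity `γ_A(ε)` of a set `A`: the infimum of all `γ > 0` such that the
closed ball of radius `γ` about the midpoint of `x₁, x₂` meets `A` whenever `x₁, x₂ ∈ A` are at
distance at most `ε`. -/
def modulusOfNonconvexity (A : Set E) (ε : ℝ) : ℝ :=
  sInf {γ : ℝ | 0 < γ ∧ ∀ x₁ ∈ A, ∀ x₂ ∈ A, ‖x₁ - x₂‖ ≤ ε →
    (Metric.closedBall (midpoint ℝ x₁ x₂) γ ∩ A).Nonempty}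

/-- `A` is weakly convex with modulus of nonconvexity `γ_A` on `[0, b)`: it is closed and
`γ_A(ε) < ε / 2` for `0 < ε < b` (at `ε = 0` the modulus is `0`). -/
def WeaklyConvexOn (A : Set E) (b : ℝ) : Prop :=
  IsClosed A ∧ ∀ ε : ℝ, 0 < ε → ε < b → modulusOfNonconvexity A ε < ε / 2

/-- The metric projection `P_A x`: the set of points of `A` nearest to `x`. -/
def metricProjection (A : Set E) (x : E) : Set E :=
  {a | a ∈ A ∧ ‖x - a‖ = Metric.infDist x A}

/-- `f` is a continuous retraction of the whole space onto `A`. -/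
def IsContinuousRetraction (f : E → E) (A : Set E) : Prop :=
  Continuous f ∧ (∀ x, f x ∈ A) ∧ ∀ x ∈ A, f x = x

end

/-!
The key notion is uniform well-posedness of the nearest-point problem: points of a set that almost
realise the distance from `y` are close together, uniformly in `y`. In a complete space this gives a
single nearest point (minimising sequences are Cauchy) and uniform continuity of the projection.

For the closed convex hull `K` of `A` well-posedness, uniform on balls, is uniform convexity of the
norm (`uniformlyWellPosed_of_convex`). For `A` and `y ∈ K` one has `dist y A ≤ 2 * r < d`, because
`A` has diameter at most `2 * r`. If `x₁, x₂ ∈ A` almost realise this distance and `ε = ‖x₁ - x₂‖`,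
the hypothesis on the moduli gives a point of `A` at distance less than `d * δ_E (ε / d)` from their
midpoint. That point is closer to `y` than `dist y A`, a contradiction, provided that midpoints in a
ball of radius `R < d` are
deeper than `d * δ_E (ε / d)` by an amount independent of `ε`. The uniform gain is needed since the
hypothesis gives a strict inequality for each `ε` but no gap as `ε` varies. It is
`exists_norm_le_sub_of_midpointDepth`: after a translation that makes the `R`-ball touch the `d`-ball
from inside at the offending point, one of the two points lies well inside the `d`-ball, and can be
moved outwards without approaching the other, unless the two are nearly opposite. That last case
contradicts `MidpointDepth.exists_le_half_sub`, which needs dimension at least two. On a line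
there is no gain at all, but there weak convexity forces `A` to be convex
(`WeaklyConvexOn.convex_of_rank_le_one`).
-/

/-- Points of `A` that almost realise the distance from `y` to `A` are close together, uniformly
in `y ∈ S`. -/
def UniformlyWellPosed {E : Type*} [NormedAddCommGroup E] (S A : Set E) : Prop :=
  ∀ η : ℝ, 0 < η → ∃ κ : ℝ, 0 < κ ∧ ∀ y ∈ S, ∀ x₁ ∈ A, ∀ x₂ ∈ A,
    ‖x₁ - y‖ ≤ Metric.infDist y A + κ → ‖x₂ - y‖ ≤ Metric.infDist y A + κ → ‖x₁ - x₂‖ ≤ η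

/-- The midpoint of two points of the closed `d`-ball about `0` at distance `ε` has depth at least
`s` in that ball. For `s ≥ 0` this says that the ball of radius `s` about the midpoint stays in the
`d`-ball, so that `d * δ_E (ε / d)` is the supremum of the possible `s`. -/
def MidpointDepth (E : Type*) [NormedAddCommGroup E] (d ε s : ℝ) : Prop :=
  ∀ p q : E, ‖p‖ ≤ d → ‖q‖ ≤ d → ‖p - q‖ = ε → ‖p + q‖ / 2 + s ≤ d

/-! ### Well-posed nearest-point problems -/

section WellPosed

variable {E : Type*} [NormedAddCommGroup E]

theorem metricProjection_eq_singleton_self [NormedSpace ℝ E] {A : Set E} {x : E}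
    (hx : x ∈ A) : metricProjection A x = {x} := by
  ext z
  simp only [metricProjection, Set.mem_ofPred_eq, Set.mem_singleton_iff,
    Metric.infDist_zero_of_mem hx, norm_eq_zero, sub_eq_zero]
  exact ⟨fun h => h.2.symm, fun h => ⟨h ▸ hx, h.symm⟩⟩

theorem UniformlyWellPosed.exists_metricProjection_eq_singleton [NormedSpace ℝ E] [CompleteSpace E]
    {S A : Set E} (h : UniformlyWellPosed S A) (hA : IsClosed A) (hne : A.Nonempty) {y : E}
    (hy : y ∈ S) : ∃ p, metricProjection A y = {p} := by
  have hseq : ∀ n : ℕ, ∃ a ∈ A, dist y a < Metric.infDist y A + 1 / ((n : ℝ) + 1) := fun n =>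
    (Metric.infDist_lt_iff hne).1 (lt_add_of_pos_right _ Nat.one_div_pos_of_nat)
  choose u huA hu using hseq
  have hcauchy : CauchySeq u := by
    rw [Metric.cauchySeq_iff']
    intro η hη
    obtain ⟨κ, hκ, H⟩ := h (η / 2) (by linarith)
    obtain ⟨N, hN⟩ := exists_nat_one_div_lt hκ
    refine ⟨N, fun n hn => ?_⟩
    have hle : 1 / ((n : ℝ) + 1) ≤ 1 / ((N : ℝ) + 1) := Nat.one_div_le_one_div hn
    have := H y hy (u n) (huA n) (u N) (huA N)
      (by rw [← dist_eq_norm, dist_comm]; linarith [hu n])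
      (by rw [← dist_eq_norm, dist_comm]; linarith [hu N])
    rw [dist_eq_norm]
    linarith
  obtain ⟨p, hp⟩ := cauchySeq_tendsto_of_complete hcauchy
  have hpA : p ∈ A := hA.mem_of_tendsto hp (Filter.Eventually.of_forall huA)
  have hpd : dist y p ≤ Metric.infDist y A := by
    have h1 : Filter.Tendsto (fun n => dist y (u n)) Filter.atTop (nhds (dist y p)) :=
      tendsto_const_nhds.dist hp
    have h2 : Filter.Tendsto (fun n : ℕ => Metric.infDist y A + 1 / ((n : ℝ) + 1)) Filter.atTop
        (nhds (Metric.infDist y A + 0)) :=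
      tendsto_const_nhds.add tendsto_one_div_add_atTop_nhds_zero_nat
    simpa using le_of_tendsto_of_tendsto' h1 h2 fun n => (hu n).le
  have hpeq : ‖y - p‖ = Metric.infDist y A := by
    rw [← dist_eq_norm]
    exact le_antisymm hpd (Metric.infDist_le_dist_of_mem hpA)
  refine ⟨p, Set.eq_singleton_iff_unique_mem.2 ⟨⟨hpA, hpeq⟩, fun q hq => ?_⟩⟩
  have hqp : ‖q - p‖ ≤ 0 := by
    refine le_of_forall_pos_le_add fun η hη => ?_
    obtain ⟨κ, hκ, H⟩ := h η hη
    have := H y hy q hq.1 p hpA (by rw [norm_sub_rev, hq.2]; linarith)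
      (by rw [norm_sub_rev, hpeq]; linarith)
    linarith
  exact sub_eq_zero.1 (norm_le_zero_iff.1 hqp)

/-- The projection of a point near `y` almost realises the distance from `y`. -/
theorem UniformlyWellPosed.uniformContinuousOn [NormedSpace ℝ E] {S A : Set E}
    (h : UniformlyWellPosed S A) {P : E → E} (hP : ∀ y ∈ S, metricProjection A y = {P y}) :
    UniformContinuousOn P S := by
  have hmem : ∀ y ∈ S, P y ∈ A ∧ ‖y - P y‖ = Metric.infDist y A := fun y hy =>
    show P y ∈ metricProjection A y from (hP y hy).symm ▸ rfl
  rw [Metric.uniformContinuousOn_iff]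
  intro η hη
  obtain ⟨κ, hκ, H⟩ := h (η / 2) (by linarith)
  refine ⟨κ / 2, by linarith, fun y hy y' hy' hyy => ?_⟩
  have h1 : ‖P y' - y‖ ≤ Metric.infDist y A + κ := by
    have t1 : ‖P y' - y‖ ≤ ‖y' - P y'‖ + ‖y - y'‖ := by
      rw [norm_sub_rev (y') (P y'), norm_sub_rev y y']
      exact norm_sub_le_norm_sub_add_norm_sub _ _ _
    have t2 : Metric.infDist y' A ≤ Metric.infDist y A + dist y' y :=
      Metric.infDist_le_infDist_add_dist
    rw [dist_comm] at t2
    rw [(hmem y' hy').2, ← dist_eq_norm y y'] at t1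
    linarith
  have := H y hy (P y) (hmem y hy).1 (P y') (hmem y' hy').1
    (by rw [norm_sub_rev, (hmem y hy).2]; linarith) h1
  rw [dist_eq_norm]
  linarith

end WellPosed

/-! ### Depth of midpoints in balls of a uniformly convex space -/

section UniformConvexity

variable {E : Type*} [NormedAddCommGroup E] [NormedSpace ℝ E]

theorem exists_unit_smul_norm_eq [Nontrivial E] (z : E) : ∃ u : E, ‖u‖ = 1 ∧ ‖z‖ • u = z := by
  by_cases hz : z = 0
  · obtain ⟨u, hu⟩ := exists_norm_eq E zero_le_one
    exact ⟨u, hu, by simp [hz]⟩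
  · exact ⟨‖z‖⁻¹ • z, norm_smul_inv_norm hz, by
      rw [smul_smul, mul_inv_cancel₀ (norm_ne_zero_iff.2 hz), one_smul]⟩

theorem norm_add_smul_of_norm_smul_eq {z u : E} (hu : ‖u‖ = 1) (hz : ‖z‖ • u = z) {t : ℝ}
    (ht : 0 ≤ t) : ‖z + t • u‖ = ‖z‖ + t := by
  conv_lhs => rw [← hz]
  rw [← add_smul, norm_smul, hu, mul_one, Real.norm_of_nonneg (by positivity)]

theorem norm_add_smul_le_of_unit {x u : E} (hu : ‖u‖ = 1) {R d : ℝ} (hx : ‖x‖ ≤ R) (hR : R ≤ d) :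
    ‖x + (d - R) • u‖ ≤ d := by
  have := norm_add_le x ((d - R) • u)
  rw [norm_smul, hu, mul_one, Real.norm_of_nonneg (by linarith)] at this
  linarith

/-- Translating two points of the `r`-ball by `R - r` in the direction of their sum puts them into
the `R`-ball, and lengthens half the sum by exactly `R - r`. So the gain found at radius `R` serves
all smaller radii. -/
theorem exists_gain_norm_add_le [UniformConvexSpace E] {η : ℝ} (hη : 0 < η) (R : ℝ) :
    ∃ δ : ℝ, 0 < δ ∧ ∀ r ≤ R, ∀ x y : E, ‖x‖ ≤ r → ‖y‖ ≤ r → η ≤ ‖x - y‖ →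
      ‖x + y‖ ≤ 2 * r - δ := by
  obtain ⟨δ, hδ, H⟩ := exists_forall_closed_ball_dist_add_le_two_mul_sub E hη R
  refine ⟨δ, hδ, fun r hr x y hx hy hxy => ?_⟩
  have hne : x - y ≠ 0 := norm_pos_iff.1 (hη.trans_le hxy)
  have : Nontrivial E := ⟨_, _, hne⟩
  obtain ⟨u, hu, hz⟩ := exists_unit_smul_norm_eq (x + y)
  have h1 := H (norm_add_smul_le_of_unit hu hx hr) (norm_add_smul_le_of_unit hu hy hr)
    (by rwa [add_sub_add_right_eq_sub])
  rw [show x + (R - r) • u + (y + (R - r) • u) = (x + y) + (2 * (R - r)) • u by module,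
    norm_add_smul_of_norm_smul_eq hu hz (by linarith)] at h1
  linarith

theorem uniformlyWellPosed_of_convex [UniformConvexSpace E] {K S : Set E} (hK : Convex ℝ K)
    {M : ℝ} (hM : ∀ x ∈ S, Metric.infDist x K ≤ M) : UniformlyWellPosed S K := by
  intro η hη
  obtain ⟨δ, hδ, H⟩ := exists_gain_norm_add_le (E := E) hη (M + 1)
  refine ⟨min 1 (δ / 4), by positivity, fun x hx x₁ h₁ x₂ h₂ hn₁ hn₂ => ?_⟩
  by_contra! hlt
  have h := H _ (add_le_add (hM x hx) (min_le_left _ _)) _ _ hn₁ hn₂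
    (by rw [sub_sub_sub_cancel_right]; exact hlt.le)
  have hm : Metric.infDist x K ≤ ‖midpoint ℝ x₁ x₂ - x‖ := by
    rw [← dist_eq_norm, dist_comm]
    exact Metric.infDist_le_dist_of_mem (hK.midpoint_mem h₁ h₂)
  have he : midpoint ℝ x₁ x₂ - x = (1 / 2 : ℝ) • ((x₁ - x) + (x₂ - x)) := by
    rw [midpoint_eq_smul_add, invOf_eq_inv]
    module
  rw [he, norm_smul, Real.norm_of_nonneg (by norm_num)] at hm
  linarith [min_le_right 1 (δ / 4)]

/-- Pairs further apart than `ε` are shrunk symmetrically about their midpoint. -/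
theorem MidpointDepth.of_le_norm_sub {d ε s : ℝ} (h : MidpointDepth E d ε s) (hε : 0 < ε)
    {p q : E} (hp : ‖p‖ ≤ d) (hq : ‖q‖ ≤ d) (hpq : ε ≤ ‖p - q‖) : ‖p + q‖ / 2 + s ≤ d := by
  set t : ℝ := ε / ‖p - q‖ with ht
  have hpos : 0 < ‖p - q‖ := hε.trans_le hpq
  have ht0 : 0 ≤ t := by positivity
  have ht1 : t ≤ 1 := (div_le_one hpos).2 hpq
  have key : ∀ x y : E, ‖x‖ ≤ d → ‖y‖ ≤ d → ‖((1 + t) / 2) • x + ((1 - t) / 2) • y‖ ≤ d := by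
    intro x y hx hy
    have := convex_closedBall (0 : E) d (mem_closedBall_zero_iff.2 hx)
      (mem_closedBall_zero_iff.2 hy) (show (0 : ℝ) ≤ (1 + t) / 2 by linarith)
      (show (0 : ℝ) ≤ (1 - t) / 2 by linarith) (by ring)
    exact mem_closedBall_zero_iff.1 this
  have := h _ _ (key p q hp hq) (key q p hq hp) (by
    rw [show ((1 + t) / 2) • p + ((1 - t) / 2) • q - (((1 + t) / 2) • q + ((1 - t) / 2) • p)
      = t • (p - q) by module, norm_smul, Real.norm_of_nonneg ht0, ht, div_mul_cancel₀ _ hpos.ne'])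
  rwa [show ((1 + t) / 2) • p + ((1 - t) / 2) • q + (((1 + t) / 2) • q + ((1 - t) / 2) • p)
    = p + q by module] at this

/-- In dimension at least two the depth of midpoints is bounded away from `ε / 2`, the value it has
on a line. There are `p` and `q` on the sphere at distance `ε`; if the midpoint `m` were almost as
deep as `ε / 2`, the triangle inequality would almost be an equality for both `m + w` and `m - w`,
where `w = (p - q) / 2`, and `m` would have nearly the directions of both `w` and `-w`. -/
theorem MidpointDepth.exists_le_half_sub [UniformConvexSpace E] (hE : 1 < Module.rank ℝ E)
    {d R ε₀ : ℝ} (hR : R < d) (hε₀ : 0 < ε₀) :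
    ∃ c : ℝ, 0 < c ∧ ∀ ε s : ℝ, ε₀ ≤ ε → ε ≤ 2 * R → MidpointDepth E d ε s → s ≤ ε / 2 - c := by
  have : Nontrivial E := (rank_pos_iff_nontrivial (R := ℝ)).1 (zero_lt_one.trans hE)
  set k : ℝ := min (d - R) (ε₀ / 2) with hk
  have hk0 : 0 < k := lt_min (by linarith) (by linarith)
  have hkd : k ≤ d - R := min_le_left _ _
  have hkε : k ≤ ε₀ / 2 := min_le_right _ _
  obtain ⟨δ, hδ, H⟩ := exists_gain_norm_add_le (E := E) hk0 k
  refine ⟨min (δ / 2) (k / 2), by positivity, fun ε s hε hεR h => ?_⟩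
  have hd : 0 ≤ d := by linarith
  obtain ⟨p, hp⟩ := exists_norm_eq E hd
  obtain ⟨q, hq, hpq⟩ : ∃ q ∈ Metric.sphere (0 : E) d, ‖p - q‖ = ε := by
    have hcont : ContinuousOn (fun q : E => ‖p - q‖) (Metric.sphere (0 : E) d) := by fun_prop
    have := (isPreconnected_sphere hE (0 : E) d).intermediate_value
      (mem_sphere_zero_iff_norm.2 hp) (mem_sphere_zero_iff_norm.2 (show ‖-p‖ = d by rwa [norm_neg]))
      hcont
    refine this ⟨by simp; linarith, ?_⟩
    rw [sub_neg_eq_add, ← two_smul ℝ p, norm_smul, hp]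
    norm_num
    linarith
  rw [mem_sphere_zero_iff_norm] at hq
  have hdep := h p q hp.le hq.le hpq
  set m : E := (1 / 2 : ℝ) • (p + q) with hm
  set w : E := (1 / 2 : ℝ) • (p - q) with hw
  have hmn : ‖m‖ = ‖p + q‖ / 2 := by
    rw [hm, norm_smul, Real.norm_of_nonneg (by norm_num)]; ring
  have hwn : ‖w‖ = ε / 2 := by
    rw [hw, norm_smul, Real.norm_of_nonneg (by norm_num), hpq]; ring
  have hpmw : m + w = p := by rw [hm, hw]; module
  have hqmw : m - w = q := by rw [hm, hw]; module
  have hmk : k ≤ ‖m‖ := by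
    have := norm_add_le m w
    rw [hpmw, hp, hwn] at this
    linarith
  have hwk : k ≤ ‖w‖ := by rw [hwn]; linarith
  by_contra! hs
  have hclose : ‖m‖ + ‖w‖ < d + min (δ / 2) (k / 2) := by rw [hwn, hmn]; linarith
  obtain ⟨a, ha, ham⟩ := exists_unit_smul_norm_eq m
  obtain ⟨b, hb, hbw⟩ := exists_unit_smul_norm_eq w
  have hplus : d ≤ ‖k • a + k • b‖ + (‖m‖ - k) + (‖w‖ - k) := by
    have e : p = (k • a + k • b) + (‖m‖ - k) • a + (‖w‖ - k) • b := by
      rw [sub_smul, sub_smul, ham, hbw, ← hpmw]; abel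
    have := norm_add₃_le (a := k • a + k • b) (b := (‖m‖ - k) • a) (c := (‖w‖ - k) • b)
    rw [← e, hp, norm_smul (‖m‖ - k), norm_smul (‖w‖ - k), ha, hb,
      Real.norm_of_nonneg (by linarith), Real.norm_of_nonneg (by linarith)] at this
    linarith
  have hminus : d ≤ ‖k • a - k • b‖ + (‖m‖ - k) + (‖w‖ - k) := by
    have e : q = (k • a - k • b) + (‖m‖ - k) • a + (-(‖w‖ - k)) • b := by
      rw [neg_smul, sub_smul, sub_smul, ham, hbw, ← hqmw]; abel
    have := norm_add₃_le (a := k • a - k • b) (b := (‖m‖ - k) • a) (c := (-(‖w‖ - k)) • b)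
    rw [← e, hq, norm_smul (‖m‖ - k), norm_smul (-(‖w‖ - k)), ha, hb, norm_neg,
      Real.norm_of_nonneg (by linarith), Real.norm_of_nonneg (by linarith)] at this
    linarith
  have hka : ∀ v : E, ‖v‖ = 1 → ‖k • v‖ ≤ k := fun v hv => by
    rw [norm_smul, hv, Real.norm_of_nonneg hk0.le, mul_one]
  have hgain := H k le_rfl _ _ (hka a ha) (hka b hb)
    (by linarith [min_le_right (δ / 2) (k / 2)])
  linarith [min_le_left (δ / 2) (k / 2)]

/-- In the `d`-ball a pair whose first point has depth `η` can have that point moved by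
`v = (η / 2) • u + (η / (2 * ε)) • (x - y)` without coming closer together. If a point `z` near the
midpoint has norm almost `d`, this forces `x - y` to be nearly `-ε • u`, for the direction `u` of
`z`, and then the midpoint is as deep as `ε / 2`. -/
theorem MidpointDepth.half_sub_le {d ε s η κ : ℝ} (h : MidpointDepth E d ε s) (hε : 0 < ε)
    (hη : 0 < η) {x y z u : E} (hx : ‖x‖ ≤ d - η) (hy : ‖y‖ ≤ d) (hxy : ‖x - y‖ = ε)
    (hu : ‖u‖ = 1) (hzu : ‖z‖ • u = z) (hzm : ‖z - (1 / 2 : ℝ) • (x + y)‖ ≤ s)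
    (hz : d - κ ≤ ‖z‖) (hz0 : z ≠ 0) : ε / 2 - κ - 2 * κ * ε / η ≤ s := by
  obtain ⟨f, hf, hfz⟩ := exists_dual_vector ℝ z (norm_ne_zero_iff.2 hz0)
  have hfle : ∀ v : E, f v ≤ ‖v‖ := fun v => by
    have := f.le_opNorm v
    rw [hf, one_mul] at this
    exact (le_abs_self _).trans this
  have hfz' : f z = ‖z‖ := by simpa using hfz
  have hfu : f u = 1 := by
    have h1 : f (‖z‖ • u) = ‖z‖ := by rw [hzu, hfz']
    rw [map_smul, smul_eq_mul] at h1
    exact mul_left_cancel₀ (norm_ne_zero_iff.2 hz0) (h1.trans (mul_one _).symm)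
  set v : E := (η / 2) • u + (η / (2 * ε)) • (x - y) with hv
  have hvn : ‖v‖ ≤ η := by
    refine (norm_add_le _ _).trans (le_of_eq ?_)
    rw [norm_smul, norm_smul, hu, hxy, Real.norm_of_nonneg (by positivity),
      Real.norm_of_nonneg (by positivity)]
    field_simp
    ring
  have hfar : ε ≤ ‖x + v - y‖ := by
    have e : x + v - y = (1 + η / (2 * ε)) • (x - y) - (-(η / 2)) • u := by rw [hv]; module
    have := norm_sub_norm_le ((1 + η / (2 * ε)) • (x - y)) ((-(η / 2)) • u)
    rw [← e, norm_smul, norm_smul, hu, hxy, norm_neg, Real.norm_of_nonneg (by positivity),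
      Real.norm_of_nonneg (by positivity)] at this
    have e2 : (1 + η / (2 * ε)) * ε - η / 2 * 1 = ε := by field_simp; ring
    linarith
  have hdep := h.of_le_norm_sub hε ((norm_add_le _ _).trans (add_le_add hx hvn) |>.trans
    (by linarith)) hy hfar
  have h1 := hfle (x + v + y)
  have h2 := hfle (z - (1 / 2 : ℝ) • (x + y))
  have h3 := (hfle y).trans hy
  simp only [hv, map_add, map_sub, map_smul, smul_eq_mul, hfu, hfz'] at h1 h2
  have h4 : η / 2 * (1 + (f x - f y) / ε) ≤ 2 * κ := by
    have e : η / 2 * (1 + (f x - f y) / ε) = η / 2 * 1 + η / (2 * ε) * (f x - f y) := by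
      field_simp
    linarith
  have h5 : (f x - f y) ≤ 4 * κ * ε / η - ε := by
    have : ε * (1 + (f x - f y) / ε) ≤ ε * (4 * κ / η) := by
      refine mul_le_mul_of_nonneg_left ?_ hε.le
      rw [le_div_iff₀ hη]
      linarith
    have e : ε * (1 + (f x - f y) / ε) = ε + (f x - f y) := by field_simp
    have e2 : ε * (4 * κ / η) = 4 * κ * ε / η := by ring
    linarith
  have e3 : 4 * κ * ε / η = 2 * (2 * κ * ε / η) := by ring
  linarith

/-- For a radius `R < d` the depth of midpoints in the `d`-ball is exceeded in the `R`-ball by a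
fixed amount. -/
theorem exists_norm_le_sub_of_midpointDepth [UniformConvexSpace E] (hE : 1 < Module.rank ℝ E)
    {d R ε₀ : ℝ} (hd : 0 < d) (hdR : d ≤ 2 * R) (hR : R < d) (hε₀ : 0 < ε₀) :
    ∃ κ : ℝ, 0 < κ ∧ ∀ ε s : ℝ, ε₀ ≤ ε → MidpointDepth E d ε s →
      ∀ r ≤ R, ∀ x y z : E, ‖x‖ ≤ r → ‖y‖ ≤ r → ‖x - y‖ = ε →
        ‖z - (1 / 2 : ℝ) • (x + y)‖ ≤ s → ‖z‖ ≤ r - κ := by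
  have : Nontrivial E := (rank_pos_iff_nontrivial (R := ℝ)).1 (zero_lt_one.trans hE)
  have hR0 : 0 < R := by linarith
  obtain ⟨c, hc, hcs⟩ := MidpointDepth.exists_le_half_sub hE hR hε₀
  obtain ⟨δ, hδ, hUC⟩ := exists_gain_norm_add_le (E := E) (half_pos hε₀) R
  -- The shift `d - R` is the fraction `t` of `R`, so that `x + (d - R) • u` is a convex combination
  -- of `x` and `x + R • u`.
  set t : ℝ := (d - R) / R with ht
  have ht0 : 0 < t := div_pos (by linarith) hR0
  have ht1 : t ≤ 1 := (div_le_one hR0).2 (by linarith)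
  have htR : t * R = d - R := div_mul_cancel₀ _ hR0.ne'
  set η : ℝ := t * δ / 2 with hη
  have hη0 : 0 < η := by positivity
  -- Of the two shifted points at least one has norm at most `d - η`: otherwise both `x` and `y` are
  -- close to `R • u`.
  have hlow : ∀ x u : E, ‖x‖ ≤ R → ‖u‖ = 1 → d - η < ‖x + (d - R) • u‖ →
      ‖x - R • u‖ < ε₀ / 2 := by
    intro x u hx hu hlt
    by_contra! hge
    have h1 := hUC R le_rfl x (R • u) hx
      (by rw [norm_smul, hu, Real.norm_of_nonneg hR0.le, mul_one]) hge
    have h2 := norm_add_le ((1 - t) • x) (t • (x + R • u))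
    rw [show (1 - t) • x + t • (x + R • u) = x + (t * R) • u by module, htR, norm_smul, norm_smul,
      Real.norm_of_nonneg ht0.le, Real.norm_of_nonneg (sub_nonneg.2 ht1)] at h2
    have h3 : (1 - t) * ‖x‖ ≤ (1 - t) * R := mul_le_mul_of_nonneg_left hx (sub_nonneg.2 ht1)
    have h4 : t * ‖x + R • u‖ ≤ t * (2 * R - δ) := mul_le_mul_of_nonneg_left h1 ht0.le
    have h5 : 0 < t * δ := by positivity
    linarith
  set κ : ℝ := c / (2 * (1 + 4 * R / η)) with hκ
  have hκ0 : 0 < κ := by positivity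
  have hκc : κ + 4 * κ * R / η = c / 2 := by
    have hne : 1 + 4 * R / η ≠ 0 := by positivity
    have : κ * (1 + 4 * R / η) = c / 2 := by rw [hκ]; field_simp
    linear_combination this
  refine ⟨min κ (d / 2), by positivity, fun ε s hε h r hr x y z hx hy hxy hzm => ?_⟩
  by_contra! hlt
  have hε0 : 0 < ε := hε₀.trans_le hε
  obtain ⟨u, hu, hzu⟩ := exists_unit_smul_norm_eq z
  -- First shift from radius `r` to `R`, then from `R` to `d`.
  have hsx := norm_add_smul_le_of_unit hu hx hr
  have hsy := norm_add_smul_le_of_unit hu hy hr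
  have hshift : ∀ v : E, v + (R - r) • u + (d - R) • u = v + (d - r) • u := fun v => by module
  have hrd : 0 ≤ d - r := by linarith
  have hzn : ‖z + (d - r) • u‖ = ‖z‖ + (d - r) := norm_add_smul_of_norm_smul_eq hu hzu hrd
  have hzge : d - κ ≤ ‖z + (d - r) • u‖ := by
    rw [hzn]; linarith [min_le_left κ (d / 2)]
  have hz0 : z + (d - r) • u ≠ 0 := by
    rw [← norm_pos_iff, hzn]; linarith [min_le_right κ (d / 2)]
  have hzu' : ‖z + (d - r) • u‖ • u = z + (d - r) • u := by
    rw [hzn, add_smul, hzu]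
  have hεR : ε ≤ 2 * R := by
    have := norm_sub_le x y
    linarith
  have hsc := hcs ε s hε hεR h
  have main : ∀ x y : E, ‖x + (d - r) • u‖ ≤ d - η → ‖y + (d - r) • u‖ ≤ d → ‖x - y‖ = ε →
      ‖z - (1 / 2 : ℝ) • (x + y)‖ ≤ s → False := by
    intro x y hx hy hxy hzm
    have h1 := h.half_sub_le hε0 hη0 hx hy (by rwa [add_sub_add_right_eq_sub]) hu hzu'
      (by rwa [show z + (d - r) • u - (1 / 2 : ℝ) • (x + (d - r) • u + (y + (d - r) • u))
        = z - (1 / 2 : ℝ) • (x + y) by module]) hzge hz0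
    have h2 : 2 * κ * ε / η ≤ 4 * κ * R / η := by
      rw [show 4 * κ * R = 2 * κ * (2 * R) by ring]
      gcongr
    linarith
  have hdx : ‖x + (d - r) • u‖ ≤ d := norm_add_smul_le_of_unit hu hx (by linarith)
  have hdy : ‖y + (d - r) • u‖ ≤ d := norm_add_smul_le_of_unit hu hy (by linarith)
  by_cases h1 : ‖x + (d - r) • u‖ ≤ d - η
  · exact main x y h1 hdy hxy hzm
  by_cases h2 : ‖y + (d - r) • u‖ ≤ d - η
  · exact main y x h2 hdx (by rwa [norm_sub_rev]) (by rwa [add_comm y x])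
  have h1' := hlow _ u hsx hu (by rw [hshift]; exact not_le.1 h1)
  have h2' := hlow _ u hsy hu (by rw [hshift]; exact not_le.1 h2)
  have h3 := norm_sub_le_norm_sub_add_norm_sub (x + (R - r) • u) (R • u) (y + (R - r) • u)
  rw [add_sub_add_right_eq_sub, hxy, norm_sub_rev (R • u)] at h3
  linarith

end UniformConvexity

/-! ### Moduli of convexity and nonconvexity -/

section Moduli

variable {E : Type*} [NormedAddCommGroup E] [NormedSpace ℝ E]

theorem exists_midpointDepth_of_lt [Nontrivial E] {d ε γ : ℝ} (hd : 0 < d)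
    (h : γ < d * spaceModulusOfConvexity E (ε / d)) : ∃ s, γ < s ∧ MidpointDepth E d ε s := by
  rw [spaceModulusOfConvexity, modulusOfConvexity, ← div_lt_iff₀' hd] at h
  obtain ⟨δ, ⟨hδ0, hδ⟩, hlt⟩ := exists_lt_of_lt_csSup (by
    refine ⟨0, le_rfl, fun x₁ h₁ x₂ h₂ _ => ?_⟩
    rw [Metric.closedBall_zero, Set.singleton_subset_iff]
    exact (convex_closedBall _ _).midpoint_mem h₁ h₂) h
  refine ⟨d * δ, (div_lt_iff₀' hd).1 hlt, fun p q hp hq hpq => ?_⟩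
  have hunit : ∀ x : E, ‖x‖ ≤ d → d⁻¹ • x ∈ Metric.closedBall (0 : E) 1 := fun x hx => by
    rw [mem_closedBall_zero_iff, norm_smul, norm_inv, Real.norm_of_nonneg hd.le]
    exact (inv_mul_le_one₀ hd).2 hx
  have hsub := hδ _ (hunit p hp) _ (hunit q hq) (by
    rw [← smul_sub, norm_smul, norm_inv, Real.norm_of_nonneg hd.le, hpq]; field_simp)
  obtain ⟨u, hu, hm⟩ := exists_unit_smul_norm_eq (midpoint ℝ (d⁻¹ • p) (d⁻¹ • q))
  have h1 : midpoint ℝ (d⁻¹ • p) (d⁻¹ • q) + δ • u ∈ Metric.closedBall (0 : E) 1 := by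
    refine hsub ?_
    rw [mem_closedBall_iff_norm, add_sub_cancel_left, norm_smul, hu, Real.norm_of_nonneg hδ0,
      mul_one]
  rw [mem_closedBall_zero_iff, norm_add_smul_of_norm_smul_eq hu hm hδ0, midpoint_eq_smul_add,
    ← smul_add, norm_smul, norm_smul, norm_inv, Real.norm_of_nonneg hd.le, invOf_eq_inv, norm_inv,
    Real.norm_of_nonneg (by norm_num)] at h1
  have h2 := mul_le_mul_of_nonneg_left h1 hd.le
  have e : d * (2⁻¹ * (d⁻¹ * ‖p + q‖) + δ) = ‖p + q‖ / 2 + d * δ := by field_simp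
  linarith

/-- The infimum defining the modulus of nonconvexity is over a nonempty set, since balls about the
midpoint of radius at least `ε / 2` contain the two points themselves. -/
theorem exists_mem_norm_sub_midpoint_lt {A : Set E} {ε s : ℝ} (hε : 0 < ε)
    (h : modulusOfNonconvexity A ε < s) {x₁ x₂ : E} (h₁ : x₁ ∈ A) (h₂ : x₂ ∈ A)
    (hx : ‖x₁ - x₂‖ = ε) : ∃ z ∈ A, ‖z - (1 / 2 : ℝ) • (x₁ + x₂)‖ < s := by
  obtain ⟨γ, ⟨-, hγ⟩, hlt⟩ := exists_lt_of_csInf_lt (by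
    refine ⟨ε, hε, fun a ha b _ hab => ⟨a, ?_, ha⟩⟩
    rw [Metric.mem_closedBall, dist_left_midpoint, dist_eq_norm, Real.norm_of_nonneg zero_le_two]
    linarith [norm_nonneg (a - b)]) h
  obtain ⟨z, hz, hzA⟩ := hγ x₁ h₁ x₂ h₂ hx.le
  refine ⟨z, hzA, ?_⟩
  rw [mem_closedBall_iff_norm, midpoint_eq_smul_add, invOf_eq_inv, ← one_div] at hz
  exact hz.trans_lt hlt

/-- The ends of a gap in a closed subset of a line are points of the set, and no point of the set is
closer to their midpoint. -/
theorem WeaklyConvexOn.convex_of_rank_le_one (hE : Module.rank ℝ E ≤ 1) {A : Set E} {b : ℝ}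
    (hA : WeaklyConvexOn A b) (hb : ∀ x ∈ A, ∀ y ∈ A, ‖x - y‖ < b) : Convex ℝ A := by
  obtain ⟨v, hv⟩ := rank_le_one_iff.1 hE
  set S : Set ℝ := {t | t • v ∈ A} with hS
  have hSc : IsClosed S := hA.1.preimage (by fun_prop)
  have hconn : S.OrdConnected := by
    refine ⟨fun t₁ h₁ t₂ h₂ t ht => ?_⟩
    by_contra htS
    have hv0 : v ≠ 0 := by
      rintro rfl
      exact htS (by simpa [hS] using h₁)
    have hvn : 0 < ‖v‖ := norm_pos_iff.2 hv0
    obtain ⟨hα, hαt⟩ := (hSc.inter isClosed_Iic).csSup_mem ⟨t₁, h₁, ht.1⟩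
      (bddAbove_Iic.mono (Set.inter_subset_right (s := S) (t := Set.Iic t)))
    obtain ⟨hβ, hβt⟩ := (hSc.inter isClosed_Ici).csInf_mem ⟨t₂, h₂, ht.2⟩
      (bddBelow_Ici.mono (Set.inter_subset_right (s := S) (t := Set.Ici t)))
    have hle : ∀ c ∈ S, c ≤ t → c ≤ sSup (S ∩ Set.Iic t) := fun c hc hct =>
      le_csSup (bddAbove_Iic.mono Set.inter_subset_right) ⟨hc, hct⟩
    have hge : ∀ c ∈ S, t ≤ c → sInf (S ∩ Set.Ici t) ≤ c := fun c hc hct =>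
      csInf_le (bddBelow_Ici.mono Set.inter_subset_right) ⟨hc, hct⟩
    generalize sSup (S ∩ Set.Iic t) = α at *
    generalize sInf (S ∩ Set.Ici t) = β at *
    have hαlt : α < t := lt_of_le_of_ne hαt fun e => htS (e ▸ hα)
    have hβlt : t < β := lt_of_le_of_ne hβt fun e => htS (e ▸ hβ)
    have hdist : ‖β • v - α • v‖ = (β - α) * ‖v‖ := by
      rw [← sub_smul, norm_smul, Real.norm_of_nonneg (by linarith)]
    have hpos : 0 < (β - α) * ‖v‖ := mul_pos (by linarith) hvn
    obtain ⟨z, hzA, hz⟩ := exists_mem_norm_sub_midpoint_lt hpos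
      (hA.2 _ hpos (hdist ▸ hb _ hβ _ hα)) hβ hα hdist
    obtain ⟨c, rfl⟩ := hv z
    rw [show c • v - (1 / 2 : ℝ) • (β • v + α • v) = (c - (β + α) / 2) • v by module, norm_smul,
      mul_div_right_comm, mul_lt_mul_iff_left₀ hvn, Real.norm_eq_abs, abs_lt] at hz
    rcases le_total c t with hct | hct
    · linarith [hle c hzA hct]
    · linarith [hge c hzA hct]
  have himg : A = (fun t : ℝ => t • v) '' S := by
    ext x
    constructor
    · intro hx
      obtain ⟨t, rfl⟩ := hv x
      exact ⟨t, hx, rfl⟩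
    · rintro ⟨t, ht, rfl⟩
      exact ht
  rw [himg]
  exact hconn.convex.is_linear_image (LinearMap.toSpanSingleton ℝ E v).isLinear

theorem uniformlyWellPosed_of_modulusOfNonconvexity_lt [UniformConvexSpace E]
    (hE : 1 < Module.rank ℝ E) {A S : Set E} {d M : ℝ} (hd : 0 < d) (hM : M < d)
    (hmod : ∀ ε : ℝ, 0 < ε → ε < 2 * d →
      modulusOfNonconvexity A ε < d * spaceModulusOfConvexity E (ε / d))
    (hS : ∀ y ∈ S, Metric.infDist y A ≤ M) : UniformlyWellPosed S A := by
  have : Nontrivial E := (rank_pos_iff_nontrivial (R := ℝ)).1 (zero_lt_one.trans hE)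
  intro η hη
  -- Any radius in `(M, d)` that is at least `d / 2` will do.
  obtain ⟨R, hRM, hRd⟩ := exists_between (max_lt hM (half_lt_self hd))
  obtain ⟨hMR, hdR⟩ := max_lt_iff.1 hRM
  obtain ⟨κ, hκ, H⟩ := exists_norm_le_sub_of_midpointDepth hE hd (by linarith) hRd hη
  refine ⟨min (κ / 2) (R - M), lt_min (by linarith) (by linarith),
    fun y hy x₁ h₁ x₂ h₂ hn₁ hn₂ => ?_⟩
  by_contra! hlt
  have hrR : Metric.infDist y A + min (κ / 2) (R - M) ≤ R := by
    linarith [hS y hy, min_le_right (κ / 2) (R - M)]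
  have hεd : ‖x₁ - x₂‖ < 2 * d := by
    have := norm_sub_le (x₁ - y) (x₂ - y)
    rw [sub_sub_sub_cancel_right] at this
    linarith
  have hε : 0 < ‖x₁ - x₂‖ := hη.trans hlt
  obtain ⟨s, hs, hdep⟩ := exists_midpointDepth_of_lt hd (hmod _ hε hεd)
  obtain ⟨z, hzA, hz⟩ := exists_mem_norm_sub_midpoint_lt hε hs h₁ h₂ rfl
  have h3 := H _ s hlt.le hdep _ hrR (x₁ - y) (x₂ - y) (z - y) hn₁ hn₂
    (by rw [sub_sub_sub_cancel_right]) (by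
      rw [show z - y - (1 / 2 : ℝ) • (x₁ - y + (x₂ - y)) = z - (1 / 2 : ℝ) • (x₁ + x₂) by module]
      exact hz.le)
  have h4 := Metric.infDist_le_dist_of_mem (x := y) hzA
  rw [dist_comm, dist_eq_norm] at h4
  linarith [min_le_left (κ / 2) (R - M)]

end Moduli

/-! ### The retraction -/

theorem theorem3p4 {E : Type*} [NormedAddCommGroup E] [NormedSpace ℝ E] [CompleteSpace E]
    [UniformConvexSpace E] (A : Set E) (hne : A.Nonempty) (d r : ℝ) (a : E) (hd : 0 < d)
    (hA : WeaklyConvexOn A (2 * d))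
    (hmod : ∀ ε : ℝ, 0 < ε → ε < 2 * d →
      modulusOfNonconvexity A ε < d * spaceModulusOfConvexity E (ε / d))
    (hball : A ⊆ Metric.closedBall a r) (hr : 2 * r < d) :
    ∃ f : E → E, IsContinuousRetraction f A ∧
      (∀ x : E, ∃ y : E, metricProjection (closure (convexHull ℝ A)) x = {y} ∧
        metricProjection A y = {f x}) ∧
      ∀ (c : E) (R : ℝ), UniformContinuousOn f (Metric.closedBall c R) := by
  obtain ⟨b, hbA⟩ := hne
  have hdiam : ∀ x ∈ A, ∀ y ∈ A, dist x y ≤ 2 * r := fun x hx y hy => by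
    have h1 := Metric.mem_closedBall.1 (hball hx)
    have h2 := Metric.mem_closedBall.1 (hball hy)
    linarith [dist_triangle_right x y a]
  set K : Set E := closure (convexHull ℝ A) with hK
  have hKc : IsClosed K := isClosed_closure
  have hKconv : Convex ℝ K := (convex_convexHull ℝ A).closure
  have hAK : A ⊆ K := (subset_convexHull ℝ A).trans subset_closure
  have hKdist : ∀ y ∈ K, Metric.infDist y A ≤ 2 * r := fun y hy =>
    (Metric.infDist_le_dist_of_mem hbA).trans <| Metric.mem_closedBall.1 <|
      closure_minimal (convexHull_min (fun x hx => Metric.mem_closedBall.2 (hdiam x hx b hbA))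
        (convex_closedBall b (2 * r))) Metric.isClosed_closedBall hy
  have hwpA : UniformlyWellPosed K A := by
    rcases lt_or_ge 1 (Module.rank ℝ E) with hE | hE
    · exact uniformlyWellPosed_of_modulusOfNonconvexity_lt hE hd hr hmod hKdist
    · exact uniformlyWellPosed_of_convex (hA.convex_of_rank_le_one hE fun x hx y hy => by
        rw [← dist_eq_norm]; linarith [hdiam x hx y hy]) hKdist
  have hwpK : ∀ (c : E) (R : ℝ), UniformlyWellPosed (Metric.closedBall c R) K := fun c R =>
    uniformlyWellPosed_of_convex hKconv (M := R + dist c b) fun x hx =>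
      (Metric.infDist_le_dist_of_mem (hAK hbA)).trans <| (dist_triangle x c b).trans <|
        add_le_add_left (Metric.mem_closedBall.1 hx) _
  have hexK : ∀ x, ∃ p, metricProjection K x = {p} := fun x =>
    (hwpK x 0).exists_metricProjection_eq_singleton hKc ⟨b, hAK hbA⟩
      (Metric.mem_closedBall_self le_rfl)
  choose P hP using hexK
  have hPK : ∀ x, P x ∈ K := fun x =>
    (show P x ∈ metricProjection K x from (hP x).symm ▸ rfl).1
  have hexA : ∀ y, ∃ p, y ∈ K → metricProjection A y = {p} := fun y => by
    by_cases hy : y ∈ K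
    · obtain ⟨p, hp⟩ := hwpA.exists_metricProjection_eq_singleton hA.1 ⟨b, hbA⟩ hy
      exact ⟨p, fun _ => hp⟩
    · exact ⟨y, fun h => absurd h hy⟩
  choose Q hQ using hexA
  have huc : ∀ (c : E) (R : ℝ), UniformContinuousOn (Q ∘ P) (Metric.closedBall c R) := fun c R =>
    (hwpA.uniformContinuousOn hQ).comp ((hwpK c R).uniformContinuousOn fun x _ => hP x)
      fun x _ => hPK x
  refine ⟨Q ∘ P, ⟨?_, fun x => ?_, fun x hx => ?_⟩, fun x => ⟨P x, hP x, hQ _ (hPK x)⟩, huc⟩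
  · exact continuous_iff_continuousAt.2 fun x =>
      (huc x 1).continuousOn.continuousAt (Metric.closedBall_mem_nhds x one_pos)
  · exact (show Q (P x) ∈ metricProjection A (P x) from (hQ _ (hPK x)).symm ▸ rfl).1
  · have h1 : P x = x := Set.singleton_injective
      ((hP x).symm.trans (metricProjection_eq_singleton_self (hAK hx)))
    have h2 : Q x = x := Set.singleton_injective
      ((hQ x (hAK hx)).symm.trans (metricProjection_eq_singleton_self hx))
    rw [Function.comp_apply, h1, h2]
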